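/- **Theorem (quantum query lower bound $\Omega(\sqrt{nm})$ for minimum spanning tree and single source shortest paths).** *Graphs and problems.* Graphs are simple (no loops, no multiple edges) on the vertex set $\{0,\dots,n-1\}$, with edge weights in $\mathbb N$. In *Minimum Spanning Tree* (MST) the graph is undirected and the task is to output a cycle-free edge set of maximal cardinality that has minimum total weight among such sets. In *Single Source Shortest Paths* (SSSP) the graph is directed and the task is to output, for every vertex $v$ reachable from the vertex $0$, some shortest (minimum total weight) path from $0$ to $v$. *Query models.* In the matrix model an algorithm queries the $n\times n$ weight matrix, whose entry is $\infty$ where there is no edge. In the adjacency array model the (out-)degrees $d_0,\dots,d_{n-1}$ are known, and a query $(i,j)$ with $j<d_i$ returns the $j$-th neighbour of $i$, in an arbitrary order, with the weight of the edge leading to it. A quantum query algorithm making $T$ queries prepares $U_TO_xU_{T-1}O_x\cdots O_xU_0|\mathrm{start}\rangle$, where $O_x|i,b,z\rangle=|i,b+x_i,z\rangle$ and the unitaries $U_t$ act on a finite-dimensional space and do not depend on the input $x$, then measures in the computational basis and outputs a function of the result. It solves a problem with error $\varepsilon$ if on every admissible input its output is correct with probability at least $1-\varepsilon$. *Theorem.*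 For every $0\le\varepsilon<\tfrac12$ there are $c>0$ and $n_0$ such that for all $n\ge n_0$, $m\ge n-1$ and $W\ge1$: 1. if $m\le n(n-1)/2$, there are degrees $d_0,\dots,d_{n-1}$ with $\sum_i d_i=2m$ such that every quantum algorithm in the array model that solves MST with error $\varepsilon$ on all undirected graphs with these degrees and with weights in $\{0,\dots,W\}$ makes at least $c\sqrt{nm}$ queries; and every quantum algorithm in the matrix model that solves MST with error $\varepsilon$ on all undirected graphs with $n$ vertices, $m$ edges and weights in $\{0,\dots,W\}$ makes at least $c\sqrt{nm}$ queries; 2. if $m\le n(n-1)$, there are out-degrees $d_0,\dots,d_{n-1}$ with $\sum_i d_i=m$ such that every quantum algorithm in the array model that solves SSSP with error $\varepsilon$ on all directed graphs with these out-degrees and with weights in $\{0,\dots,W\}$ makes at least $c\sqrt{nm}$ queries; and every quantum algorithm in the matrix model that solves SSSP with error $\varepsilon$ on all directed graphs with $n$ vertices, $m$ edges and weights in $\{0,\dots,W\}$ makes at least $c\sqrt{nm}$ queries. -/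

import Mathlib

/-! ### Quantum query algorithms -/

/-- A quantum query algorithm whose input is a black-box function `x : Q → A` and
whose output lies in `Out`. The basis states are `|i, b, z⟩` with `i` in the query register `Q`,
`b` in the answer register `A` and `z` in a work register of arbitrary finite dimension. The
algorithm alternates arbitrary unitaries, which do not depend on the input, with queries; at the
end all registers are measured and a function of the observed basis state is output. -/
structure QueryAlgorithm (Q A Out : Type) [Fintype Q] [DecidableEq Q] [Fintype A]
    [DecidableEq A] where
  /-- the number of queries -/
  queries : ℕ
  /-- the dimension of the work register -/
  work : ℕ
  /-- the initial basis state -/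
  start : Q × A × Fin work
  /-- `unitary t` is the unitary applied after `t` queries have been made -/
  unitary : ℕ → Matrix.unitaryGroup (Q × A × Fin work) ℂ
  /-- the output, as a function of the measured basis state -/
  output : Q × A × Fin work → Out

namespace QueryAlgorithm

variable {Q A Out : Type} [Fintype Q] [DecidableEq Q] [Fintype A] [DecidableEq A]

/-- One query to `x`: the unitary `|i, b, z⟩ ↦ |i, b + x i, z⟩`, acting on amplitude vectors. -/
def applyQuery [AddCommGroup A] {k : ℕ} (x : Q → A) (ψ : Q × A × Fin k → ℂ) :
    Q × A × Fin k → ℂ :=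
  fun s => ψ (s.1, s.2.1 - x s.1, s.2.2)

/-- The state `U_t O_x U_{t-1} O_x ⋯ O_x U_0 |start⟩`. -/
def stateAfter [AddCommGroup A] (𝒜 : QueryAlgorithm Q A Out) (x : Q → A) :
    ℕ → (Q × A × Fin 𝒜.work → ℂ)
  | 0 => (𝒜.unitary 0).1.mulVec (Pi.single 𝒜.start 1)
  | t + 1 => (𝒜.unitary (t + 1)).1.mulVec (applyQuery x (stateAfter 𝒜 x t))

open Classical in
/-- The probability that the output of the algorithm on input `x` is in the set `good`. -/
noncomputable def successProb [AddCommGroup A] (𝒜 : QueryAlgorithm Q A Out) (x : Q → A)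
    (good : Set Out) : ℝ :=
  ∑ s, if 𝒜.output s ∈ good then ‖𝒜.stateAfter x 𝒜.queries s‖ ^ 2 else 0

end QueryAlgorithm

/-! ### Weighted graphs -/

/-- A simple (loopless, without multiple edges) directed graph on the vertices `Fin n` with
weights in the natural numbers, given by its weight matrix; the weight `⊤` means that there is no
edge. -/
structure WeightedDigraph (n : ℕ) where
  weight : Fin n → Fin n → ℕ∞
  loopless : ∀ i, weight i i = ⊤

/-- A simple undirected graph on the vertices `Fin n` with weights in the natural numbers. -/
structure WeightedGraph (n : ℕ) extends WeightedDigraph n where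
  symm : ∀ i j, weight i j = weight j i

/-- The number of edges of a directed graph. -/
noncomputable def WeightedDigraph.numEdges {n : ℕ} (G : WeightedDigraph n) : ℕ :=
  {e : Fin n × Fin n | G.weight e.1 e.2 ≠ ⊤}.ncard

namespace WeightedGraph

variable {n : ℕ} (G : WeightedGraph n)

/-- The underlying unweighted graph. -/
def toSimpleGraph : SimpleGraph (Fin n) where
  Adj i j := G.weight i j ≠ ⊤
  symm := ⟨fun i j h => by rw [G.symm j i]; exact h⟩
  loopless := ⟨fun i h => h (G.loopless i)⟩

/-- The number of (undirected) edges. -/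
noncomputable def numUndirectedEdges : ℕ := G.toSimpleGraph.edgeSet.ncard

/-- The weight of an undirected edge. -/
def edgeWeight (e : Sym2 (Fin n)) : ℕ∞ := Sym2.lift ⟨G.weight, G.symm⟩ e

/-- `F` is a cycle-free set of edges of `G`. -/
def IsForest (F : Finset (Sym2 (Fin n))) : Prop :=
  (F : Set (Sym2 (Fin n))) ⊆ G.toSimpleGraph.edgeSet ∧
    (SimpleGraph.fromEdgeSet (F : Set (Sym2 (Fin n)))).IsAcyclic

/-- The minimum spanning trees (spanning forests, if `G` is not connected): the cycle-free edge
sets of maximal cardinality that have minimum total weight. -/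
def minSpanningTrees : Set (Finset (Sym2 (Fin n))) :=
  {F | G.IsForest F ∧ (∀ F', G.IsForest F' → F'.card ≤ F.card) ∧
    ∀ F', G.IsForest F' → F'.card = F.card →
      ∑ e ∈ F, G.edgeWeight e ≤ ∑ e ∈ F', G.edgeWeight e}

end WeightedGraph

namespace WeightedDigraph

variable {n : ℕ} (G : WeightedDigraph n)

/-- `p` is the vertex sequence of a directed path from `s` to `v`. -/
def IsPath (s v : Fin n) (p : List (Fin n)) : Prop :=
  p.head? = some s ∧ p.getLast? = some v ∧ p.Nodup ∧ p.IsChain (fun a b => G.weight a b ≠ ⊤)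

/-- The length of a path: the total weight of its edges. -/
def pathLength (p : List (Fin n)) : ℕ∞ := (List.zipWith G.weight p p.tail).sum

/-- The correct solutions of single source shortest paths with source `s`: for every vertex `v`
that can be reached from `s`, a shortest path from `s` to `v`. -/
def shortestPathSolutions (s : Fin n) : Set (Fin n → List (Fin n)) :=
  {P | ∀ v, (∃ p, G.IsPath s v p) →
    G.IsPath s v (P v) ∧ ∀ p, G.IsPath s v p → G.pathLength (P v) ≤ G.pathLength p}

/-- The adjacency array model, for weights in `{0, …, W}`: `f ⟨i, j⟩` is the `j`-th neighbour of
`i` (in an arbitrary order) with the weight of the edge to it; `d i` is the (out-)degree of `i`. -/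
def HasArrays {W : ℕ} {d : Fin n → ℕ} (f : (Σ i, Fin (d i)) → Fin n × Fin (W + 1)) : Prop :=
  (∀ i, Function.Injective fun j => (f ⟨i, j⟩).1) ∧
    ∀ (i i' : Fin n) (a : ℕ), G.weight i i' = (a : ℕ∞) ↔
      ∃ j, (f ⟨i, j⟩).1 = i' ∧ ((f ⟨i, j⟩).2 : ℕ) = a

/-- The matrix model, for weights in `{0, …, W}`: the entries of `M` are the weights, where
the last element `W + 1` of `Fin (W + 2)` encodes `∞`. -/
def HasMatrix {W : ℕ} (M : Fin n × Fin n → Fin (W + 2)) : Prop :=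
  ∀ i j, G.weight i j = if M (i, j) = Fin.last (W + 1) then ⊤ else ((M (i, j) : ℕ) : ℕ∞)

end WeightedDigraph

/-! ### Solving the two problems in the two models -/

namespace QueryAlgorithm

variable {n W : ℕ} [NeZero n]

/-- The algorithm solves Minimum Spanning Tree with error probability at most `ε` in the array
model, on all graphs with degrees `d` (which are known) and weights in `{0, …, W}`. -/
def SolvesMSTArray {d : Fin n → ℕ} (ε : ℝ)
    (𝒜 : QueryAlgorithm (Σ i, Fin (d i)) (Fin n × Fin (W + 1)) (Finset (Sym2 (Fin n)))) : Prop :=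
  ∀ (G : WeightedGraph n) (f : (Σ i, Fin (d i)) → Fin n × Fin (W + 1)), G.HasArrays f →
    1 - ε ≤ 𝒜.successProb f G.minSpanningTrees

/-- The algorithm solves Minimum Spanning Tree with error probability at most `ε` in the matrix
model, on all graphs with `n` vertices, `m` edges and weights in `{0, …, W}`. -/
def SolvesMSTMatrix (m : ℕ) (ε : ℝ)
    (𝒜 : QueryAlgorithm (Fin n × Fin n) (Fin (W + 2)) (Finset (Sym2 (Fin n)))) : Prop :=
  ∀ (G : WeightedGraph n) (M : Fin n × Fin n → Fin (W + 2)), G.numUndirectedEdges = m →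
    G.HasMatrix M → 1 - ε ≤ 𝒜.successProb M G.minSpanningTrees

/-- The algorithm solves Single Source Shortest Paths, with the source `0`, with error probability
at most `ε` in the array model, on all directed graphs with out-degrees `d` (which are known) and
weights in `{0, …, W}`. -/
def SolvesSSSPArray {d : Fin n → ℕ} (ε : ℝ)
    (𝒜 : QueryAlgorithm (Σ i, Fin (d i)) (Fin n × Fin (W + 1)) (Fin n → List (Fin n))) : Prop :=
  ∀ (G : WeightedDigraph n) (f : (Σ i, Fin (d i)) → Fin n × Fin (W + 1)), G.HasArrays f →
    1 - ε ≤ 𝒜.successProb f (G.shortestPathSolutions 0)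

/-- The algorithm solves Single Source Shortest Paths, with the source `0`, with error probability
at most `ε` in the matrix model, on all directed graphs with `n` vertices, `m` edges and weights in
`{0, …, W}`. -/
def SolvesSSSPMatrix (m : ℕ) (ε : ℝ)
    (𝒜 : QueryAlgorithm (Fin n × Fin n) (Fin (W + 2)) (Fin n → List (Fin n))) : Prop :=
  ∀ (G : WeightedDigraph n) (M : Fin n × Fin n → Fin (W + 2)), G.numEdges = m →
    G.HasMatrix M → 1 - ε ≤ 𝒜.successProb M (G.shortestPathSolutions 0)

end QueryAlgorithm

/-! Hide `σ : Fin r → Fin k` in the weights of a fixed graph. The vertex `0` is joined to `k` middle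
vertices, and these are completely joined to `r` leaves; further edges pad the graph to exactly `m`.
All edges at `0` towards the middle layer weigh 0, leaf `i` has one edge of weight 0 from the middle
layer, to vertex `σ i`, and all remaining edges weigh 1. The zero edges form a forest, so they lie
in every minimum spanning tree. Likewise a shortest path from `0` to leaf `i` has length 0 and must
enter through `σ i`. Either output thus determines `σ`, while one query, in either model, tests at
most one equation `σ i = j`.

Finding `r` independent hidden positions among `k` candidates each costs of order `r * √k` queries,
by an adversary argument (`le_queries_of_hidden_positions`). The potential is the sum of the inner
products of the states on inputs `σ` and `σ` with one coordinate replaced. It starts at `k ^ r * r *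
k`. At the end each pair of distinct inputs has overlap at most `1 - (1 - 2 * ε) ^ 2 / 2`
(`overlap_queries_le`), so the potential has dropped by order `k ^ r * r * k`. One query lowers it
by at most `2 * √(k - 1) * k ^ r` (`totalOverlap_sub_succ_le`).

With `r` about `n / 8` and `k` about `m / (4 * n)` the graph fits into `n` vertices and `m` edges,
and `r * √k` is of order `√(n * m)` (`exists_layer_sizes`). -/

set_option linter.unusedSectionVars false

open Finset Matrix

/-! ### Overlaps of states and the effect of one query -/

namespace QueryAlgorithm

variable {Q A Out : Type} [Fintype Q] [DecidableEq Q] [Fintype A] [DecidableEq A] [AddCommGroup A]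

/-- The probability of observing `q` in the query register. -/
noncomputable def queryMass {k : ℕ} (ψ : Q × A × Fin k → ℂ) (q : Q) : ℝ :=
  ∑ s : A × Fin k, ‖ψ (q, s)‖ ^ 2

lemma queryMass_applyQuery {k : ℕ} (x : Q → A) (ψ : Q × A × Fin k → ℂ) (q : Q) :
    queryMass (applyQuery x ψ) q = queryMass ψ q := by
  unfold queryMass
  exact Equiv.sum_comp ((Equiv.subRight (x q)).prodCongr (Equiv.refl (Fin k)))
    fun s => ‖ψ (q, s)‖ ^ 2

lemma sum_queryMass {k : ℕ} (ψ : Q × A × Fin k → ℂ) :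
    ∑ q, queryMass ψ q = ∑ s, ‖ψ s‖ ^ 2 := by
  simp only [queryMass]
  rw [Fintype.sum_prod_type]

/-- The part of the real inner product of two states that comes from the query `q`. -/
noncomputable def queryOverlap {k : ℕ} (φ ψ : Q × A × Fin k → ℂ) (q : Q) : ℝ :=
  ∑ s : A × Fin k, (star (φ (q, s)) * ψ (q, s)).re

lemma sum_queryOverlap {k : ℕ} (φ ψ : Q × A × Fin k → ℂ) :
    ∑ q, queryOverlap φ ψ q = (star φ ⬝ᵥ ψ).re := by
  simp only [queryOverlap, dotProduct, Complex.re_sum, Pi.star_apply]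
  rw [Fintype.sum_prod_type]

/-- Weighted AM-GM; the freedom in `c` is what later allows unequal weights for the two inputs of a
pair. -/
lemma abs_re_star_mul_le (a b : ℂ) {c : ℝ} (hc : 0 < c) :
    |(star a * b).re| ≤ (c * ‖a‖ ^ 2 + c⁻¹ * ‖b‖ ^ 2) / 2 := by
  have h1 : |(star a * b).re| ≤ ‖a‖ * ‖b‖ := by
    simpa using Complex.abs_re_le_norm (star a * b)
  have h2 : (c * ‖a‖ ^ 2 + c⁻¹ * ‖b‖ ^ 2) / 2 - ‖a‖ * ‖b‖ = c⁻¹ * (c * ‖a‖ - ‖b‖) ^ 2 / 2 := by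
    field_simp
    ring
  have h3 : 0 ≤ c⁻¹ * (c * ‖a‖ - ‖b‖) ^ 2 / 2 := by positivity
  linarith

lemma abs_queryOverlap_le {k : ℕ} (φ ψ : Q × A × Fin k → ℂ) (q : Q) {c : ℝ} (hc : 0 < c) :
    |queryOverlap φ ψ q| ≤ (c * queryMass φ q + c⁻¹ * queryMass ψ q) / 2 := by
  unfold queryOverlap queryMass
  refine (Finset.abs_sum_le_sum_abs _ _).trans ?_
  rw [Finset.mul_sum, Finset.mul_sum, ← Finset.sum_add_distrib, Finset.sum_div]
  exact Finset.sum_le_sum fun s _ => abs_re_star_mul_le _ _ hc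

/-- Inputs agreeing at `q` shift the answer register by the same amount, so both states are permuted
alike there. Only positions where the inputs differ can change an overlap. -/
lemma queryOverlap_applyQuery_of_eq {k : ℕ} {x y : Q → A} (φ ψ : Q × A × Fin k → ℂ) {q : Q}
    (h : x q = y q) :
    queryOverlap (applyQuery x φ) (applyQuery y ψ) q = queryOverlap φ ψ q := by
  unfold queryOverlap
  simp only [applyQuery, h]
  exact Equiv.sum_comp ((Equiv.subRight (y q)).prodCongr (Equiv.refl (Fin k)))
    fun s => (star (φ (q, s)) * ψ (q, s)).re

lemma queryOverlap_sub_applyQuery_le {k : ℕ} (x y : Q → A) (φ ψ : Q × A × Fin k → ℂ) (q : Q)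
    {c : ℝ} (hc : 0 < c) :
    queryOverlap φ ψ q - queryOverlap (applyQuery x φ) (applyQuery y ψ) q ≤
      c * queryMass φ q + c⁻¹ * queryMass ψ q := by
  have h1 := (abs_le.1 (abs_queryOverlap_le φ ψ q hc)).2
  have h2 := (abs_le.1 (abs_queryOverlap_le (applyQuery x φ) (applyQuery y ψ) q hc)).1
  rw [queryMass_applyQuery, queryMass_applyQuery] at h2
  linarith

lemma star_mulVec_dotProduct_mulVec {ι : Type} [Fintype ι] [DecidableEq ι]
    (U : Matrix.unitaryGroup ι ℂ) (φ ψ : ι → ℂ) :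
    star (U.1 *ᵥ φ) ⬝ᵥ (U.1 *ᵥ ψ) = star φ ⬝ᵥ ψ := by
  rw [Matrix.star_mulVec, Matrix.dotProduct_mulVec, Matrix.vecMul_vecMul,
    ← Matrix.star_eq_conjTranspose, Matrix.UnitaryGroup.star_mul_self, Matrix.vecMul_one]

lemma re_star_dotProduct_self {ι : Type} [Fintype ι] (ψ : ι → ℂ) :
    (star ψ ⬝ᵥ ψ).re = ∑ s, ‖ψ s‖ ^ 2 := by
  simp only [dotProduct, Complex.re_sum, Pi.star_apply]
  refine Finset.sum_congr rfl fun s _ => ?_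
  rw [← Complex.normSq_eq_norm_sq, Complex.normSq_apply]
  simp

variable (𝒜 : QueryAlgorithm Q A Out)

/-- The real inner product of the states on inputs `x` and `y` after `t` queries. -/
noncomputable def overlap (t : ℕ) (x y : Q → A) : ℝ :=
  (star (𝒜.stateAfter x t) ⬝ᵥ 𝒜.stateAfter y t).re

lemma overlap_zero (x y : Q → A) : 𝒜.overlap 0 x y = 1 := by
  unfold overlap stateAfter
  rw [star_mulVec_dotProduct_mulVec]
  simp [Pi.star_single]

lemma overlap_succ (t : ℕ) (x y : Q → A) :
    𝒜.overlap (t + 1) x y =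
      (star (applyQuery x (𝒜.stateAfter x t)) ⬝ᵥ applyQuery y (𝒜.stateAfter y t)).re := by
  unfold overlap
  rw [stateAfter, stateAfter, star_mulVec_dotProduct_mulVec]

lemma overlap_self (t : ℕ) (x : Q → A) : 𝒜.overlap t x x = 1 := by
  induction t with
  | zero => exact overlap_zero _ _ _
  | succ t ih =>
    rw [overlap_succ, ← ih, overlap, ← sum_queryOverlap, ← sum_queryOverlap]
    exact Finset.sum_congr rfl fun q _ => queryOverlap_applyQuery_of_eq _ _ rfl

lemma sum_norm_sq_stateAfter (t : ℕ) (x : Q → A) : ∑ s, ‖𝒜.stateAfter x t s‖ ^ 2 = 1 := by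
  rw [← re_star_dotProduct_self]
  exact 𝒜.overlap_self t x

lemma sum_queryMass_stateAfter (t : ℕ) (x : Q → A) :
    ∑ q, queryMass (𝒜.stateAfter x t) q = 1 := by
  rw [sum_queryMass, sum_norm_sq_stateAfter]

lemma overlap_sub_overlap_succ (t : ℕ) (x y : Q → A) :
    𝒜.overlap t x y - 𝒜.overlap (t + 1) x y =
      ∑ q, (queryOverlap (𝒜.stateAfter x t) (𝒜.stateAfter y t) q -
        queryOverlap (applyQuery x (𝒜.stateAfter x t)) (applyQuery y (𝒜.stateAfter y t)) q) := by
  rw [overlap_succ, overlap, ← sum_queryOverlap, ← sum_queryOverlap, Finset.sum_sub_distrib]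

/-- If an algorithm succeeds with error at most `ε` on two inputs with no common correct output,
then its final states on these inputs are far apart. -/
lemma overlap_queries_le {ε : ℝ} (hε : ε < 1 / 2) {x y : Q → A}
    {good good' : Set Out} (hdisj : Disjoint good good')
    (hx : 1 - ε ≤ 𝒜.successProb x good) (hy : 1 - ε ≤ 𝒜.successProb y good') :
    𝒜.overlap 𝒜.queries x y ≤ 1 - (1 - 2 * ε) ^ 2 / 2 := by
  classical
  set φ := 𝒜.stateAfter x 𝒜.queries with hφ
  set ψ := 𝒜.stateAfter y 𝒜.queries with hψ
  have hφ1 : ∑ s, ‖φ s‖ ^ 2 = 1 := 𝒜.sum_norm_sq_stateAfter _ x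
  have hψ1 : ∑ s, ‖ψ s‖ ^ 2 = 1 := 𝒜.sum_norm_sq_stateAfter _ y
  set p := ∑ s, if 𝒜.output s ∈ good then ‖φ s‖ ^ 2 else 0 with hp
  set q := ∑ s, if 𝒜.output s ∈ good then ‖ψ s‖ ^ 2 else 0 with hq
  have hp1 : 1 - ε ≤ p := by
    refine hx.trans (le_of_eq ?_)
    unfold successProb
    exact Finset.sum_congr rfl fun s _ => by congr
  have hq1 : q ≤ ε := by
    have h : q + 𝒜.successProb y good' ≤ 1 := by
      rw [← hψ1, hq, successProb, ← Finset.sum_add_distrib]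
      refine Finset.sum_le_sum fun s _ => ?_
      have hs : 𝒜.output s ∈ good → 𝒜.output s ∉ good' := fun h h' =>
        Set.disjoint_left.1 hdisj h h'
      by_cases h1 : 𝒜.output s ∈ good
      · simp [h1, hs h1]
      · by_cases h2 : 𝒜.output s ∈ good' <;> simp [h1, h2, hψ]
    linarith
  set D : ℝ := 1 - 2 * ε with hD
  have hD0 : 0 < D := by linarith
  -- Rational substitute for the optimal AM-GM weight `√((1 - D) / (1 + D))`; it gives exactly `1 -
  -- D ^ 2 / 2` when `p - q = D`.
  set μ : ℝ := (1 + D)⁻¹ with hμ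
  have hμ0 : 0 < μ := by positivity
  have key : 𝒜.overlap 𝒜.queries x y ≤
      (μ * p + μ⁻¹ * q) / 2 + (μ⁻¹ * (1 - p) + μ * (1 - q)) / 2 := by
    have e1 : 1 - p = ∑ s, if 𝒜.output s ∈ good then 0 else ‖φ s‖ ^ 2 := by
      rw [← hφ1, hp, ← Finset.sum_sub_distrib]
      exact Finset.sum_congr rfl fun s _ => by split_ifs <;> simp
    have e2 : 1 - q = ∑ s, if 𝒜.output s ∈ good then 0 else ‖ψ s‖ ^ 2 := by
      rw [← hψ1, hq, ← Finset.sum_sub_distrib]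
      exact Finset.sum_congr rfl fun s _ => by split_ifs <;> simp
    rw [e1, e2, hp, hq, overlap, dotProduct, Complex.re_sum]
    simp only [Finset.mul_sum, ← Finset.sum_add_distrib, Finset.sum_div]
    refine Finset.sum_le_sum fun s _ => ?_
    rw [Pi.star_apply]
    split_ifs
    · have := (abs_le.1 (abs_re_star_mul_le (φ s) (ψ s) hμ0)).2
      simpa using this
    · have := (abs_le.1 (abs_re_star_mul_le (φ s) (ψ s) (inv_pos.2 hμ0))).2
      simpa using this
  refine key.trans ?_
  have e : 1 - D ^ 2 / 2 - ((μ * p + μ⁻¹ * q) / 2 + (μ⁻¹ * (1 - p) + μ * (1 - q)) / 2) =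
      (p - q - D) * (D * (2 + D)) / (2 * (1 + D)) := by
    rw [hμ]
    field_simp
    ring
  have h0 : 0 ≤ (p - q - D) * (D * (2 + D)) / (2 * (1 + D)) := by
    have : 0 ≤ p - q - D := by linarith
    positivity
  linarith

end QueryAlgorithm

/-! ### The adversary bound for hidden positions -/

namespace QueryAlgorithm

variable {Q A Out : Type} [Fintype Q] [DecidableEq Q] [Fintype A] [DecidableEq A] [AddCommGroup A]
variable (𝒜 : QueryAlgorithm Q A Out)

/-- Exchanging the `i`-th value of `σ` with a given value. -/
def swapValue {r k : ℕ} (i : Fin r) :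
    ((Fin r → Fin k) × Fin k) ≃ ((Fin r → Fin k) × Fin k) where
  toFun p := (Function.update p.1 i p.2, p.1 i)
  invFun p := (Function.update p.1 i p.2, p.1 i)
  left_inv p := by simp
  right_inv p := by simp

/-- The weights of the adversary bound: `a` and `b` are the values of a coordinate for two inputs,
which are compared with `j`. -/
noncomputable def adversaryWeight {k : ℕ} (j a b : Fin k) : ℝ :=
  if a = j then (if b = j then 0 else (√((k : ℝ) - 1))⁻¹)
  else (if b = j then √((k : ℝ) - 1) else 0)

/-- The value `j` has `k - 1` partners of weight `1 / √(k - 1)`, any other value has the single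
partner `j` of weight `√(k - 1)`: the totals coincide. -/
lemma sum_adversaryWeight {k : ℕ} (hk : 2 ≤ k) (j a : Fin k) :
    ∑ b, adversaryWeight j a b = √((k : ℝ) - 1) := by
  have hk' : (2 : ℝ) ≤ k := by exact_mod_cast hk
  unfold adversaryWeight
  by_cases h : a = j
  · have e : ∀ b : Fin k, (if b = j then (0 : ℝ) else (√((k : ℝ) - 1))⁻¹) =
        (√((k : ℝ) - 1))⁻¹ - if b = j then (√((k : ℝ) - 1))⁻¹ else 0 := fun b => by
      split_ifs <;> simp
    simp only [h, if_true, e, Finset.sum_sub_distrib, Finset.sum_const, Finset.card_univ,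
      Fintype.card_fin, nsmul_eq_mul, Finset.sum_ite_eq', Finset.mem_univ]
    have hs : √((k : ℝ) - 1) * √((k : ℝ) - 1) = k - 1 := Real.mul_self_sqrt (by linarith)
    have hpos : 0 < √((k : ℝ) - 1) := Real.sqrt_pos.2 (by linarith)
    field_simp
    linarith
  · simp [h]

/-- One query position distinguishes little between pairs of inputs, on average. -/
lemma sum_queryOverlap_sub_le {r k N : ℕ} (hk : 2 ≤ k) (x : (Fin r → Fin k) → Q → A) (q : Q)
    (i : Fin r) (j : Fin k)
    (hloc : ∀ σ τ : Fin r → Fin k, (σ i = j ↔ τ i = j) → x σ q = x τ q)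
    (ψ : (Fin r → Fin k) → Q × A × Fin N → ℂ) :
    ∑ σ : Fin r → Fin k, ∑ l : Fin r, ∑ b : Fin k,
      (queryOverlap (ψ σ) (ψ (Function.update σ l b)) q -
        queryOverlap (applyQuery (x σ) (ψ σ))
          (applyQuery (x (Function.update σ l b)) (ψ (Function.update σ l b))) q) ≤
      2 * √((k : ℝ) - 1) * ∑ σ, queryMass (ψ σ) q := by
  have hk' : (2 : ℝ) ≤ k := by exact_mod_cast hk
  have hpos : 0 < √((k : ℝ) - 1) := Real.sqrt_pos.2 (by linarith)
  have step1 : ∀ σ : Fin r → Fin k, ∑ l : Fin r, ∑ b : Fin k,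
      (queryOverlap (ψ σ) (ψ (Function.update σ l b)) q -
        queryOverlap (applyQuery (x σ) (ψ σ))
          (applyQuery (x (Function.update σ l b)) (ψ (Function.update σ l b))) q) =
      ∑ b : Fin k, (queryOverlap (ψ σ) (ψ (Function.update σ i b)) q -
        queryOverlap (applyQuery (x σ) (ψ σ))
          (applyQuery (x (Function.update σ i b)) (ψ (Function.update σ i b))) q) := by
    intro σ
    refine Finset.sum_eq_single i (fun l _ hl => ?_) (by simp)
    refine Finset.sum_eq_zero fun b _ => ?_
    rw [queryOverlap_applyQuery_of_eq, sub_self]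
    exact hloc _ _ (by rw [Function.update_of_ne (Ne.symm hl)])
  -- A pair contributes only if exactly one of `σ i` and `b` is `j`; then the two weights are
  -- inverse to each other, as AM-GM requires.
  have step2 : ∀ (σ : Fin r → Fin k) (b : Fin k),
      queryOverlap (ψ σ) (ψ (Function.update σ i b)) q -
        queryOverlap (applyQuery (x σ) (ψ σ))
          (applyQuery (x (Function.update σ i b)) (ψ (Function.update σ i b))) q ≤
      adversaryWeight j (σ i) b * queryMass (ψ σ) q +
        adversaryWeight j b (σ i) * queryMass (ψ (Function.update σ i b)) q := by
    intro σ b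
    unfold adversaryWeight
    by_cases h1 : σ i = j <;> by_cases h2 : b = j
    · rw [queryOverlap_applyQuery_of_eq _ _ (hloc _ _ (by simp [h1, h2]))]
      simp [h1, h2]
    · simpa [h1, h2] using queryOverlap_sub_applyQuery_le (x σ) (x (Function.update σ i b))
        (ψ σ) (ψ (Function.update σ i b)) q (inv_pos.2 hpos)
    · simpa [h1, h2] using queryOverlap_sub_applyQuery_le (x σ) (x (Function.update σ i b))
        (ψ σ) (ψ (Function.update σ i b)) q hpos
    · rw [queryOverlap_applyQuery_of_eq _ _ (hloc _ _ (by simp [h1, h2]))]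
      simp [h1, h2]
  -- Exchanging `σ i` and `b` is an involution on the pairs that swaps the roles of the two inputs.
  have step3 : ∑ σ : Fin r → Fin k, ∑ b : Fin k,
        adversaryWeight j b (σ i) * queryMass (ψ (Function.update σ i b)) q =
      ∑ σ : Fin r → Fin k, ∑ b : Fin k, adversaryWeight j (σ i) b * queryMass (ψ σ) q := by
    rw [← Fintype.sum_prod_type', ← Fintype.sum_prod_type']
    rw [← Equiv.sum_comp (swapValue i)]
    exact Finset.sum_congr rfl fun p _ => by simp [swapValue]
  have step4 : ∑ σ : Fin r → Fin k, ∑ b : Fin k,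
        adversaryWeight j (σ i) b * queryMass (ψ σ) q =
      √((k : ℝ) - 1) * ∑ σ, queryMass (ψ σ) q := by
    simp only [← Finset.sum_mul, sum_adversaryWeight hk, Finset.mul_sum]
  calc _ ≤ ∑ σ : Fin r → Fin k, ∑ b : Fin k, (adversaryWeight j (σ i) b * queryMass (ψ σ) q +
        adversaryWeight j b (σ i) * queryMass (ψ (Function.update σ i b)) q) := by
        simp only [step1]
        exact Finset.sum_le_sum fun σ _ => Finset.sum_le_sum fun b _ => step2 σ b
    _ = _ := by
        simp only [Finset.sum_add_distrib]
        rw [step3, step4]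
        ring

/-- The sum of the overlaps over all pairs of inputs that differ in at most one coordinate. -/
noncomputable def totalOverlap {r k : ℕ} (x : (Fin r → Fin k) → Q → A) (t : ℕ) : ℝ :=
  ∑ σ : Fin r → Fin k, ∑ l : Fin r, ∑ b : Fin k,
    𝒜.overlap t (x σ) (x (Function.update σ l b))

/-- Each query position costs at most `2 * √(k - 1)` times its mass, and the masses of each of the
`k ^ r` states sum to 1. -/
lemma totalOverlap_sub_succ_le {r k : ℕ} (hk : 2 ≤ k) (x : (Fin r → Fin k) → Q → A)
    (hloc : ∀ q, ∃ i j, ∀ σ τ : Fin r → Fin k, (σ i = j ↔ τ i = j) → x σ q = x τ q) (t : ℕ) :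
    𝒜.totalOverlap x t - 𝒜.totalOverlap x (t + 1) ≤ 2 * √((k : ℝ) - 1) * (k : ℝ) ^ r := by
  unfold totalOverlap
  simp only [← Finset.sum_sub_distrib, overlap_sub_overlap_succ]
  have comm : ∀ F : (Fin r → Fin k) → Fin r → Fin k → Q → ℝ,
      ∑ σ, ∑ l, ∑ b, ∑ q, F σ l b q = ∑ q, ∑ σ, ∑ l, ∑ b, F σ l b q := by
    intro F
    rw [Finset.sum_comm (s := (Finset.univ : Finset Q))]
    refine Finset.sum_congr rfl fun σ _ => ?_
    rw [Finset.sum_comm (s := (Finset.univ : Finset Q))]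
    refine Finset.sum_congr rfl fun l _ => ?_
    rw [Finset.sum_comm (s := (Finset.univ : Finset Q))]
  rw [comm]
  have hm : ∑ q, ∑ σ, queryMass (𝒜.stateAfter (x σ) t) q = (k : ℝ) ^ r := by
    rw [Finset.sum_comm]
    simp [sum_queryMass_stateAfter]
  rw [← hm, Finset.mul_sum]
  refine Finset.sum_le_sum fun q _ => ?_
  obtain ⟨i, j, h⟩ := hloc q
  exact sum_queryOverlap_sub_le hk x q i j h fun σ => 𝒜.stateAfter (x σ) t

/-- The adversary bound for inputs that hide `r` independent positions among `k` candidates each,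
such that every query tests one candidate for one of the hidden positions. -/
theorem le_queries_of_hidden_positions {ε : ℝ} (hε : ε < 1 / 2) {r k : ℕ}
    (hk : 2 ≤ k) (x : (Fin r → Fin k) → Q → A) (good : (Fin r → Fin k) → Set Out)
    (hdisj : ∀ σ τ, σ ≠ τ → Disjoint (good σ) (good τ))
    (hloc : ∀ q, ∃ i j, ∀ σ τ : Fin r → Fin k, (σ i = j ↔ τ i = j) → x σ q = x τ q)
    (hsucc : ∀ σ, 1 - ε ≤ 𝒜.successProb (x σ) (good σ)) :
    (1 - 2 * ε) ^ 2 / 4 * (r * √((k : ℝ) - 1)) ≤ 𝒜.queries := by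
  have hk' : (2 : ℝ) ≤ k := by exact_mod_cast hk
  have hpos : 0 < √((k : ℝ) - 1) := Real.sqrt_pos.2 (by linarith)
  have hs : √((k : ℝ) - 1) * √((k : ℝ) - 1) = k - 1 := Real.mul_self_sqrt (by linarith)
  set D := (1 - 2 * ε) ^ 2 / 2 with hD
  have h0 : 𝒜.totalOverlap x 0 = (k : ℝ) ^ r * (r * k) := by
    simp [totalOverlap, overlap_zero]
  have hT : 𝒜.totalOverlap x 𝒜.queries ≤ (k : ℝ) ^ r * (r * (k - (k - 1) * D)) := by
    -- One choice of `b` leaves `σ` unchanged and has overlap 1; the other `k - 1` lose at least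
    -- `D`.
    have hrow : ∀ (σ : Fin r → Fin k) (l : Fin r), ∑ b : Fin k,
        𝒜.overlap 𝒜.queries (x σ) (x (Function.update σ l b)) ≤ k - (k - 1) * D := by
      intro σ l
      calc _ ≤ ∑ b : Fin k, ((1 - D) + if b = σ l then D else 0) := by
            refine Finset.sum_le_sum fun b _ => ?_
            by_cases hb : b = σ l
            · subst hb
              rw [Function.update_eq_self, overlap_self]
              simp
            · have hne : σ ≠ Function.update σ l b := fun h => hb (by
                have := congrFun h l
                rw [Function.update_self] at this
                exact this.symm)
              simpa [hb] using 𝒜.overlap_queries_le hε (hdisj _ _ hne) (hsucc _) (hsucc _)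
        _ = _ := by
            rw [Finset.sum_add_distrib, Finset.sum_ite_eq' Finset.univ (σ l) fun _ => D]
            simp only [Finset.sum_const, Finset.card_univ, Fintype.card_fin, nsmul_eq_mul,
              Finset.mem_univ, if_true]
            ring
    calc _ ≤ ∑ σ : Fin r → Fin k, ∑ l : Fin r, ((k : ℝ) - (k - 1) * D) :=
          Finset.sum_le_sum fun σ _ => Finset.sum_le_sum fun l _ => hrow σ l
      _ = _ := by
        simp only [Finset.sum_const, Finset.card_univ, Fintype.card_fun, Fintype.card_fin,
          nsmul_eq_mul]
        push_cast
        ring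
  have hsteps : ∀ t : ℕ, 𝒜.totalOverlap x 0 - 𝒜.totalOverlap x t ≤
      t * (2 * √((k : ℝ) - 1) * (k : ℝ) ^ r) := by
    intro t
    induction t with
    | zero => simp
    | succ t ih =>
      have := 𝒜.totalOverlap_sub_succ_le hk x hloc t
      push_cast
      linarith
  have h1 := hsteps 𝒜.queries
  have hK : (0 : ℝ) < (k : ℝ) ^ r := by positivity
  -- Compares the total drop with the drop per query, writing `k - 1` as a square so that one factor
  -- `√(k - 1)` cancels.
  have h2 : (k : ℝ) ^ r * (√((k : ℝ) - 1) * (r * √((k : ℝ) - 1) * D)) ≤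
      (k : ℝ) ^ r * (√((k : ℝ) - 1) * (𝒜.queries * 2)) := by
    have e : (k : ℝ) ^ r * (√((k : ℝ) - 1) * (r * √((k : ℝ) - 1) * D)) =
        (k : ℝ) ^ r * (r * ((k - 1) * D)) := by
      linear_combination ((k : ℝ) ^ r * r * D) * hs
    rw [e]
    linarith
  have h3 := le_of_mul_le_mul_left (le_of_mul_le_mul_left h2 hK) hpos
  rw [hD] at h3
  linarith

end QueryAlgorithm

/-! ### Acyclicity and the exchange argument for spanning trees -/

namespace SimpleGraph

variable {V : Type*} {G : SimpleGraph V}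

/-- A graph is acyclic if it has a ranking of the vertices such that no vertex has two neighbours
whose rank is at most its own. -/
lemma isAcyclic_of_rank (ρ : V → ℕ)
    (h : ∀ a b c, G.Adj a b → G.Adj a c → ρ b ≤ ρ a → ρ c ≤ ρ a → b = c) : G.IsAcyclic := by
  classical
  intro v w hw
  -- At a vertex of maximal rank on a cycle, the two cycle neighbours are distinct and of no larger
  -- rank.
  obtain ⟨a, ha, hmax⟩ := w.support.toFinset.exists_max_image ρ
    ⟨v, by simp⟩
  rw [List.mem_toFinset] at ha
  have hc := hw.rotate ha
  set c := w.rotate a ha with hc'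
  have hle : ∀ b ∈ c.support, ρ b ≤ ρ a := fun b hb => hmax b (by
    rw [List.mem_toFinset]
    exact (Walk.mem_support_rotate_iff _ _ ha).1 hb)
  have hnil : ¬ c.Nil := hc.not_nil
  exact hc.snd_ne_penultimate (h a _ _ (c.adj_snd hnil) (c.adj_penultimate hnil).symm
    (hle _ (c.getVert_mem_support 1)) (hle _ (c.getVert_mem_support _)))

end SimpleGraph

namespace WeightedGraph

variable {n : ℕ} (G : WeightedGraph n)

/-- Minimum spanning trees contain all edges of weight zero, if these form no cycle. -/
lemma edgeSet_subset_of_mem_minSpanningTrees {F : Finset (Sym2 (Fin n))}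
    (hF : F ∈ G.minSpanningTrees) {Z : SimpleGraph (Fin n)} (hZ : Z.IsAcyclic)
    (hZG : Z ≤ G.toSimpleGraph)
    (hw : ∀ e ∈ G.toSimpleGraph.edgeSet, G.edgeWeight e = 0 ↔ e ∈ Z.edgeSet) :
    Z.edgeSet ⊆ F := by
  classical
  obtain ⟨⟨hFG, hFa⟩, hcard, hmin⟩ := hF
  intro e
  induction e using Sym2.ind with | _ u v
  intro he
  by_contra heF
  set T := SimpleGraph.fromEdgeSet (F : Set (Sym2 (Fin n))) with hT
  have huv : u ≠ v := Z.ne_of_adj he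
  have heG : s(u, v) ∈ G.toSimpleGraph.edgeSet := SimpleGraph.edgeSet_mono hZG he
  -- Otherwise adding the missing edge would give a larger forest.
  have hreach : T.Reachable u v := by
    by_contra hn
    have h1 := hFa.sup_edge_of_not_reachable hn
    have h2 : G.IsForest (insert s(u, v) F) := by
      refine ⟨?_, ?_⟩
      · rw [Finset.coe_insert]
        exact Set.insert_subset heG hFG
      · refine h1.anti ?_
        rw [Finset.coe_insert, SimpleGraph.edge, hT, ← SimpleGraph.fromEdgeSet_union]
        exact SimpleGraph.fromEdgeSet_mono (by
          rw [Set.union_singleton])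
    have h3 := hcard _ h2
    rw [Finset.card_insert_of_notMem heF] at h3
    omega
  obtain ⟨p, hp⟩ := hreach.exists_isPath
  have hpF : ∀ f ∈ p.edges, f ∈ F := fun f hf => by
    have := p.edges_subset_edgeSet hf
    rw [hT, SimpleGraph.edgeSet_fromEdgeSet] at this
    exact this.1
  -- A path inside `Z` that avoids `s(u, v)` would close a cycle with it.
  obtain ⟨f, hfp, hfZ⟩ : ∃ f ∈ p.edges, f ∉ Z.edgeSet := by
    by_contra! hall
    refine (SimpleGraph.isAcyclic_iff_forall_isBridge.1 hZ he) ?_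
    refine ⟨p.transfer _ fun f hf => ?_⟩
    rw [SimpleGraph.edgeSet_deleteEdges]
    exact ⟨hall f hf, fun h => heF (h ▸ hpF f hf)⟩
  have hfF := hpF f hfp
  have hfG := hFG hfF
  -- Paths in a forest are unique, so removing `f` separates `u` from `v`, and `f` may be exchanged
  -- for `s(u, v)`.
  have hn : ¬ (SimpleGraph.fromEdgeSet (F.erase f : Set (Sym2 (Fin n)))).Reachable u v := by
    intro h
    obtain ⟨q, hq⟩ := h.exists_isPath
    have hle : SimpleGraph.fromEdgeSet (F.erase f : Set (Sym2 (Fin n))) ≤ T :=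
      SimpleGraph.fromEdgeSet_mono (by exact_mod_cast F.erase_subset f)
    have heq := (hFa.subsingleton_path u v).elim ⟨p, hp⟩ ⟨q.mapLe hle, hq.mapLe hle⟩
    have hpq : p = q.mapLe hle := congrArg Subtype.val heq
    rw [hpq, SimpleGraph.Walk.edges_mapLe_eq_edges] at hfp
    have := q.edges_subset_edgeSet hfp
    rw [SimpleGraph.edgeSet_fromEdgeSet] at this
    simpa using this.1
  have hanti : (SimpleGraph.fromEdgeSet (F.erase f : Set (Sym2 (Fin n)))).IsAcyclic :=
    hFa.anti (SimpleGraph.fromEdgeSet_mono (by exact_mod_cast F.erase_subset f))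
  have hF' : G.IsForest (insert s(u, v) (F.erase f)) := by
    refine ⟨?_, ?_⟩
    · rw [Finset.coe_insert]
      exact Set.insert_subset heG (subset_trans (by exact_mod_cast F.erase_subset f) hFG)
    · refine (hanti.sup_edge_of_not_reachable hn).anti ?_
      rw [Finset.coe_insert, SimpleGraph.edge, ← SimpleGraph.fromEdgeSet_union]
      exact SimpleGraph.fromEdgeSet_mono (by rw [Set.union_singleton])
  have heF' : s(u, v) ∉ F.erase f := fun h => heF (Finset.mem_of_mem_erase h)
  have h1 := hmin _ hF' (by
    rw [Finset.card_insert_of_notMem heF', Finset.card_erase_add_one hfF])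
  rw [Finset.sum_insert heF', (hw _ heG).2 he, zero_add, ← Finset.add_sum_erase _ _ hfF] at h1
  -- Cancelling the common edges in `ℕ∞` needs a finite sum; minimality then forces `f` to have
  -- weight 0, hence to lie in `Z`.
  have hfin : ∑ e ∈ F.erase f, G.edgeWeight e ≠ ⊤ := by
    refine ENat.sum_ne_top.2 fun g hg hgt => ?_
    have hgG := hFG (Finset.mem_of_mem_erase hg)
    induction g using Sym2.ind with | _ a b
    exact hgG hgt
  have h2 : G.edgeWeight f ≤ 0 := by
    have h3 : G.edgeWeight f + ∑ e ∈ F.erase f, G.edgeWeight e ≤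
      0 + ∑ e ∈ F.erase f, G.edgeWeight e := by rwa [zero_add]
    exact (ENat.add_le_add_iff_right hfin).1 h3
  exact hfZ ((hw f hfG).1 (le_antisymm h2 bot_le))

end WeightedGraph

/-! ### Paths of length zero -/

namespace WeightedDigraph

variable {n : ℕ} (G : WeightedDigraph n)

lemma weight_eq_zero_of_pathLength_append {l : List (Fin n)} {a b : Fin n}
    (h : G.pathLength (l ++ [a, b]) = 0) : G.weight a b = 0 := by
  induction l with
  | nil => simpa [pathLength] using h
  | cons c l ih =>
    refine ih ?_
    cases l with
    | nil =>
      simp only [pathLength, List.nil_append, List.cons_append, List.tail_cons,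
        List.zipWith_cons_cons, List.sum_cons, add_eq_zero] at h ⊢
      exact h.2
    | cons d l =>
      simp only [pathLength, List.cons_append, List.tail_cons,
        List.zipWith_cons_cons, List.sum_cons, add_eq_zero] at h ⊢
      exact h.2

/-- A path of length zero with distinct ends has a last edge, of weight zero. -/
lemma IsPath.exists_last_edge {s v : Fin n} {p : List (Fin n)} (hp : G.IsPath s v p) (hsv : s ≠ v)
    (h : G.pathLength p = 0) : ∃ l a, p = l ++ [a, v] ∧ G.weight a v = 0 := by
  obtain ⟨hhead, hlast, -, -⟩ := hp
  rcases List.eq_nil_or_concat p with rfl | ⟨q, b, rfl⟩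
  · simp at hhead
  rcases List.eq_nil_or_concat q with rfl | ⟨l, a, rfl⟩
  · simp at hhead hlast
    exact absurd (hhead.symm.trans hlast) hsv
  · have hb : b = v := by simpa using hlast
    subst hb
    have e : (l.concat a).concat b = l ++ [a, b] := by simp
    exact ⟨l, a, e, G.weight_eq_zero_of_pathLength_append (e ▸ h)⟩

end WeightedDigraph

/-! ### Graphs with weights zero and one -/

section ArcInputs

variable {n : ℕ} (E Z : Fin n → Fin n → Prop)

open Classical in
/-- The directed graph with arcs `E`, of weight zero if in `Z` and of weight one otherwise. -/
noncomputable def arcDigraph (hE : ∀ a, ¬ E a a) : WeightedDigraph n where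
  weight a b := if E a b then (if Z a b then 0 else 1) else ⊤
  loopless a := if_neg (hE a)

/-- The undirected graph with edges `E`, of weight zero if in `Z` and of weight one otherwise. -/
noncomputable def arcGraph (hE : ∀ a, ¬ E a a) (hEs : ∀ a b, E a b ↔ E b a)
    (hZs : ∀ a b, Z a b ↔ Z b a) : WeightedGraph n where
  toWeightedDigraph := arcDigraph E Z hE
  symm a b := by classical exact if_congr (hEs a b) (if_congr (hZs a b) rfl rfl) rfl

open Classical in
/-- The number of arcs of `E` that leave a vertex. -/
noncomputable def outDeg (a : Fin n) : ℕ := (univ.filter (E a)).card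

open Classical in
/-- An enumeration of the out-neighbours of a vertex. -/
noncomputable def outNeighbor (a : Fin n) : Fin (outDeg E a) ≃ {b // E a b} :=
  (univ.filter (E a)).equivFin.symm.trans (Equiv.subtypeEquivRight fun b => by simp)

open Classical in
/-- The adjacency arrays of `arcDigraph`. -/
noncomputable def arcArrays (W : ℕ) (q : Σ a, Fin (outDeg E a)) : Fin n × Fin (W + 1) :=
  ((outNeighbor E q.1 q.2).1, if Z q.1 (outNeighbor E q.1 q.2).1 then 0 else 1)

open Classical in
/-- The weight matrix of `arcDigraph`. -/
noncomputable def arcMatrix (W : ℕ) (q : Fin n × Fin n) : Fin (W + 2) :=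
  if E q.1 q.2 then (if Z q.1 q.2 then 0 else 1) else Fin.last (W + 1)

lemma hasArrays_arcDigraph (hE : ∀ a, ¬ E a a) {W : ℕ} (hW : 1 ≤ W) :
    (arcDigraph E Z hE).HasArrays (arcArrays E Z W) := by
  classical
  have h1 : ((1 : Fin (W + 1)) : ℕ) = 1 := by
    rw [Fin.val_one', Nat.mod_eq_of_lt (by omega)]
  refine ⟨fun i j j' h => (outNeighbor E i).injective (Subtype.ext h), fun i i' a => ?_⟩
  simp only [arcDigraph, arcArrays]
  constructor
  · intro h
    by_cases hii : E i i'
    · refine ⟨(outNeighbor E i).symm ⟨i', hii⟩, by simp, ?_⟩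
      rw [if_pos hii] at h
      by_cases hz : Z i i'
      · simp only [hz, if_true, Equiv.apply_symm_apply] at h ⊢
        exact_mod_cast h
      · simp only [hz, if_false, Equiv.apply_symm_apply, h1] at h ⊢
        exact_mod_cast h
    · rw [if_neg hii] at h
      exact absurd h.symm (ENat.natCast_ne_top a)
  · rintro ⟨j, rfl, rfl⟩
    rw [if_pos (outNeighbor E i j).2]
    split_ifs
    · simp
    · rw [h1, Nat.cast_one]

lemma hasMatrix_arcDigraph (hE : ∀ a, ¬ E a a) {W : ℕ} (hW : 1 ≤ W) :
    (arcDigraph E Z hE).HasMatrix (arcMatrix E Z W) := by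
  classical
  have h1 : ((1 : Fin (W + 2)) : ℕ) = 1 := by
    rw [Fin.val_one', Nat.mod_eq_of_lt (by omega)]
  -- The weight 1 must not collide with the code `W + 1` of `∞`; this needs `1 ≤ W`.
  have h2 : (1 : Fin (W + 2)) ≠ Fin.last (W + 1) := fun h => by
    have := congrArg Fin.val h
    rw [h1, Fin.val_last] at this
    omega
  have h3 : (0 : Fin (W + 2)) ≠ Fin.last (W + 1) := fun h => by
    have := congrArg Fin.val h
    rw [Fin.val_zero, Fin.val_last] at this
    omega
  intro i j
  simp only [arcDigraph, arcMatrix]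
  split_ifs <;> simp_all

lemma weight_arcDigraph_ne_top (hE : ∀ a, ¬ E a a) (a b : Fin n) :
    (arcDigraph E Z hE).weight a b ≠ ⊤ ↔ E a b := by
  simp only [arcDigraph]
  split_ifs <;> simp_all

lemma weight_arcDigraph_eq_zero (hE : ∀ a, ¬ E a a) (a b : Fin n) :
    (arcDigraph E Z hE).weight a b = 0 ↔ E a b ∧ Z a b := by
  simp only [arcDigraph]
  split_ifs <;> simp_all

variable {Z} in
-- The neighbour order depends on `E` alone, so an array entry sees `Z` only through the weight of
-- the queried arc.
lemma arcArrays_congr {Z' : Fin n → Fin n → Prop} (W : ℕ) (q : Σ a, Fin (outDeg E a))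
    (h : Z q.1 (outNeighbor E q.1 q.2).1 ↔ Z' q.1 (outNeighbor E q.1 q.2).1) :
    arcArrays E Z W q = arcArrays E Z' W q := by
  classical exact Prod.ext rfl (if_congr h rfl rfl)

variable {Z} in
lemma arcMatrix_congr {Z' : Fin n → Fin n → Prop} (W : ℕ) (q : Fin n × Fin n)
    (h : Z q.1 q.2 ↔ Z' q.1 q.2) : arcMatrix E Z W q = arcMatrix E Z' W q := by
  classical exact if_congr Iff.rfl (if_congr h rfl rfl) rfl

end ArcInputs

/-! ### The layered graphs that hide the zero weights -/

/-- Two disjoint layers of vertices other than the vertex `0`. -/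
structure Layers (n k r : ℕ) [NeZero n] where
  mid : Fin k → Fin n
  leaf : Fin r → Fin n
  mid_injective : Function.Injective mid
  leaf_injective : Function.Injective leaf
  mid_ne_leaf : ∀ j i, mid j ≠ leaf i
  mid_ne_zero : ∀ j, mid j ≠ 0
  leaf_ne_zero : ∀ i, leaf i ≠ 0

namespace Layers

variable {n k r : ℕ} [NeZero n] (L : Layers n k r)

/-- Layers of consecutive vertices. -/
lemma nonempty_of_lt (h : k + r < n) : Nonempty (Layers n k r) := by
  refine ⟨⟨fun j => ⟨j + 1, by omega⟩, fun i => ⟨k + 1 + i, by omega⟩, ?_, ?_, ?_, ?_, ?_⟩⟩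
  · intro a b hab
    simpa [Fin.ext_iff] using hab
  · intro a b hab
    simpa [Fin.ext_iff] using hab
  · intro j i hij
    have := congrArg Fin.val hij
    simp only at this
    omega
  · intro j hj
    simpa using congrArg Fin.val hj
  · intro i hi
    simpa using congrArg Fin.val hi

/-- The arcs from `0` to the first layer and from the first to the second layer. -/
def arcs : Finset (Fin n × Fin n) :=
  univ.image (fun j => (0, L.mid j)) ∪ univ.image fun p : Fin k × Fin r => (L.mid p.1, L.leaf p.2)

lemma card_arcs_le : L.arcs.card ≤ k + k * r := by
  refine (Finset.card_union_le _ _).trans (add_le_add ?_ ?_)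
  · exact Finset.card_image_le.trans (by simp)
  · exact Finset.card_image_le.trans (by simp)

lemma zero_mid_mem_arcs (j : Fin k) : (0, L.mid j) ∈ L.arcs := by
  simp [arcs]

lemma mid_leaf_mem_arcs (j : Fin k) (i : Fin r) : (L.mid j, L.leaf i) ∈ L.arcs := by
  simp [arcs]

lemma fst_ne_snd_of_mem_arcs {e : Fin n × Fin n} (he : e ∈ L.arcs) : e.1 ≠ e.2 := by
  simp only [arcs, mem_union, mem_image, mem_univ, true_and] at he
  obtain ⟨j, rfl⟩ | ⟨p, rfl⟩ := he
  · exact (L.mid_ne_zero j).symm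
  · exact L.mid_ne_leaf _ _

/-- The arcs of weight zero: all arcs from `0`, and one arc to each vertex of the second layer. -/
def ZeroArc (σ : Fin r → Fin k) (a b : Fin n) : Prop :=
  (a = 0 ∧ ∃ j, b = L.mid j) ∨ ∃ i, a = L.mid (σ i) ∧ b = L.leaf i

/-- The edges of weight zero, in either direction. -/
def ZeroEdge (σ : Fin r → Fin k) (a b : Fin n) : Prop := L.ZeroArc σ a b ∨ L.ZeroArc σ b a

lemma zeroEdge_comm (σ : Fin r → Fin k) (a b : Fin n) : L.ZeroEdge σ a b ↔ L.ZeroEdge σ b a :=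
  or_comm

lemma ZeroArc.mem_arcs {σ : Fin r → Fin k} {a b : Fin n} (h : L.ZeroArc σ a b) :
    (a, b) ∈ L.arcs := by
  obtain ⟨rfl, j, rfl⟩ | ⟨i, rfl, rfl⟩ := h
  · exact L.zero_mid_mem_arcs j
  · exact L.mid_leaf_mem_arcs _ i

lemma zeroArc_mid_leaf (σ : Fin r → Fin k) (j : Fin k) (i : Fin r) :
    L.ZeroArc σ (L.mid j) (L.leaf i) ↔ σ i = j := by
  constructor
  · rintro (⟨h, -⟩ | ⟨i', h1, h2⟩)
    · exact absurd h (L.mid_ne_zero j)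
    · rw [L.leaf_injective h2, L.mid_injective h1]
  · rintro rfl
    exact Or.inr ⟨i, rfl, rfl⟩

lemma not_zeroArc_leaf_mid (σ : Fin r → Fin k) (j : Fin k) (i : Fin r) :
    ¬ L.ZeroArc σ (L.leaf i) (L.mid j) := by
  rintro (⟨h, -⟩ | ⟨i', h1, h2⟩)
  · exact L.leaf_ne_zero i h
  · exact L.mid_ne_leaf _ _ h1.symm

lemma zeroArc_leaf {σ : Fin r → Fin k} {a : Fin n} {i : Fin r} (h : L.ZeroArc σ a (L.leaf i)) :
    a = L.mid (σ i) := by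
  obtain ⟨-, j, h⟩ | ⟨i', h1, h2⟩ := h
  · exact absurd h.symm (L.mid_ne_leaf j i)
  · rw [h1, L.leaf_injective h2]

/-- At most one zero arc enters each vertex: this makes the zero edges a forest and forces the last
arc of a shortest path. -/
lemma zeroArc_left_unique {σ : Fin r → Fin k} {a b c : Fin n} (hb : L.ZeroArc σ b a)
    (hc : L.ZeroArc σ c a) : b = c := by
  obtain ⟨rfl, j, rfl⟩ | ⟨i, rfl, rfl⟩ := hb
  · obtain ⟨rfl, -⟩ | ⟨i', -, h⟩ := hc
    · rfl
    · exact absurd h (L.mid_ne_leaf _ _)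
  · exact (L.zeroArc_leaf hc).symm

lemma zeroArc_congr_of_forall_ne {a b : Fin n} (h : ∀ j i, ¬ (a = L.mid j ∧ b = L.leaf i))
    (σ τ : Fin r → Fin k) : L.ZeroArc σ a b ↔ L.ZeroArc τ a b := by
  refine or_congr Iff.rfl ⟨?_, ?_⟩
  · rintro ⟨i, hi⟩
    exact absurd hi (h _ _)
  · rintro ⟨i, hi⟩
    exact absurd hi (h _ _)

/-- Whether an edge has weight zero depends on one hidden position only. -/
lemma exists_zeroArc_zeroEdge_congr (hk : 0 < k) (hr : 0 < r) (a b : Fin n) :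
    ∃ (i : Fin r) (j : Fin k), ∀ σ τ : Fin r → Fin k, (σ i = j ↔ τ i = j) →
      (L.ZeroArc σ a b ↔ L.ZeroArc τ a b) ∧ (L.ZeroEdge σ a b ↔ L.ZeroEdge τ a b) := by
  by_cases h : ∃ j i, a = L.mid j ∧ b = L.leaf i
  · obtain ⟨j, i, rfl, rfl⟩ := h
    refine ⟨i, j, fun σ τ hστ => ?_⟩
    simp [ZeroEdge, zeroArc_mid_leaf, not_zeroArc_leaf_mid, hστ]
  by_cases h' : ∃ j i, b = L.mid j ∧ a = L.leaf i
  · obtain ⟨j, i, rfl, rfl⟩ := h'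
    refine ⟨i, j, fun σ τ hστ => ?_⟩
    simp [ZeroEdge, zeroArc_mid_leaf, not_zeroArc_leaf_mid, hστ]
  push Not at h h'
  -- This weight does not depend on `σ`, so any position and candidate will do.
  refine ⟨⟨0, hr⟩, ⟨0, hk⟩, fun σ τ _ => ?_⟩
  have h1 := L.zeroArc_congr_of_forall_ne (fun j i hji => h j i hji.1 hji.2) σ τ
  have h2 := L.zeroArc_congr_of_forall_ne (fun j i hji => h' j i hji.1 hji.2) σ τ
  exact ⟨h1, or_congr h1 h2⟩

/-- The graph of the edges of weight zero. -/
def zeroGraph (σ : Fin r → Fin k) : SimpleGraph (Fin n) where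
  Adj := L.ZeroEdge σ
  symm := ⟨fun a b h => h.symm⟩
  loopless := ⟨fun a h => by
    rcases h with h | h <;> exact L.fst_ne_snd_of_mem_arcs (ZeroArc.mem_arcs L h) rfl⟩

/-- Rank vertices by layer. Zero arcs raise the rank, so a neighbour of no larger rank is a
predecessor, and predecessors are unique. -/
lemma isAcyclic_zeroGraph (σ : Fin r → Fin k) : (L.zeroGraph σ).IsAcyclic := by
  classical
  let ρ : Fin n → ℕ := fun a => if a = 0 then 0 else if ∃ j, a = L.mid j then 1 else 2
  have h0 : ρ 0 = 0 := if_pos rfl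
  have h1 : ∀ j, ρ (L.mid j) = 1 := fun j => by simp [ρ, L.mid_ne_zero j]
  have h2 : ∀ i, ρ (L.leaf i) = 2 := fun i => by
    simp [ρ, L.leaf_ne_zero i, fun j => (L.mid_ne_leaf j i).symm]
  have hlt : ∀ a b, L.ZeroArc σ a b → ρ a < ρ b := by
    rintro a b (⟨rfl, j, rfl⟩ | ⟨i, rfl, rfl⟩)
    · rw [h0, h1]
      exact one_pos
    · rw [h1, h2]
      exact one_lt_two
  refine SimpleGraph.isAcyclic_of_rank ρ fun a b c hab hac hb hc => ?_
  refine L.zeroArc_left_unique (hab.resolve_left fun h => ?_) (hac.resolve_left fun h => ?_)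
  · exact absurd (hlt _ _ h) hb.not_gt
  · exact absurd (hlt _ _ h) hc.not_gt

end Layers

/-! ### Lower bounds from layered graphs -/

section Arcs

variable {n W : ℕ}

/-- The inputs in the array model change only with the weights that are queried. -/
lemma exists_arcArrays_congr {r k : ℕ} (E : Fin n → Fin n → Prop)
    (Z : (Fin r → Fin k) → Fin n → Fin n → Prop)
    (hZ : ∀ a b, ∃ (i : Fin r) (j : Fin k), ∀ σ τ : Fin r → Fin k, (σ i = j ↔ τ i = j) →
      (Z σ a b ↔ Z τ a b)) (q : Σ a, Fin (outDeg E a)) :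
    ∃ i j, ∀ σ τ : Fin r → Fin k, (σ i = j ↔ τ i = j) →
      arcArrays E (Z σ) W q = arcArrays E (Z τ) W q := by
  obtain ⟨i, j, h⟩ := hZ q.1 (outNeighbor E q.1 q.2).1
  exact ⟨i, j, fun σ τ hστ => arcArrays_congr E W q (h σ τ hστ)⟩

/-- The inputs in the matrix model change only with the weights that are queried. -/
lemma exists_arcMatrix_congr {r k : ℕ} (E : Fin n → Fin n → Prop)
    (Z : (Fin r → Fin k) → Fin n → Fin n → Prop)
    (hZ : ∀ a b, ∃ (i : Fin r) (j : Fin k), ∀ σ τ : Fin r → Fin k, (σ i = j ↔ τ i = j) →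
      (Z σ a b ↔ Z τ a b)) (q : Fin n × Fin n) :
    ∃ i j, ∀ σ τ : Fin r → Fin k, (σ i = j ↔ τ i = j) →
      arcMatrix E (Z σ) W q = arcMatrix E (Z τ) W q := by
  obtain ⟨i, j, h⟩ := hZ q.1 q.2
  exact ⟨i, j, fun σ τ hστ => arcMatrix_congr E W q (h σ τ hστ)⟩

end Arcs

namespace Layers

variable {n k r : ℕ} [NeZero n] (L : Layers n k r)

section SpanningTrees

variable {S : Finset (Sym2 (Fin n))} (hS : ∀ a, s(a, a) ∉ S)

/-- The undirected graph with edges `S` whose edges of weight zero are given by `σ`. -/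
noncomputable def hidingGraph (σ : Fin r → Fin k) : WeightedGraph n :=
  arcGraph (fun a b => s(a, b) ∈ S) (L.ZeroEdge σ) hS (fun a b => by rw [Sym2.eq_swap])
    (L.zeroEdge_comm σ)

lemma edgeSet_hidingGraph (σ : Fin r → Fin k) :
    (L.hidingGraph hS σ).toSimpleGraph.edgeSet = S := by
  ext e
  induction e using Sym2.ind with | _ a b
  exact weight_arcDigraph_ne_top (fun a b => s(a, b) ∈ S) (L.ZeroEdge σ) hS a b

lemma numUndirectedEdges_hidingGraph (σ : Fin r → Fin k) :
    (L.hidingGraph hS σ).numUndirectedEdges = S.card := by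
  rw [WeightedGraph.numUndirectedEdges, edgeSet_hidingGraph, Set.ncard_coe_finset]

variable (hL : ∀ e ∈ L.arcs, s(e.1, e.2) ∈ S)
include hL

lemma mem_of_zeroEdge {σ : Fin r → Fin k} {a b : Fin n} (h : L.ZeroEdge σ a b) : s(a, b) ∈ S := by
  obtain h | h := h
  · exact hL _ (ZeroArc.mem_arcs L h)
  · rw [Sym2.eq_swap]
    exact hL _ (ZeroArc.mem_arcs L h)

lemma mem_of_mem_minSpanningTrees {σ : Fin r → Fin k} {F : Finset (Sym2 (Fin n))}
    (hF : F ∈ (L.hidingGraph hS σ).minSpanningTrees) {a b : Fin n} (h : L.ZeroArc σ a b) :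
    s(a, b) ∈ F := by
  refine WeightedGraph.edgeSet_subset_of_mem_minSpanningTrees _ hF (L.isAcyclic_zeroGraph σ)
    (fun a b hab => ?_) (fun e he => ?_) (show s(a, b) ∈ (L.zeroGraph σ).edgeSet from Or.inl h)
  · exact (weight_arcDigraph_ne_top (fun a b => s(a, b) ∈ S) (L.ZeroEdge σ) hS a b).2
      (L.mem_of_zeroEdge hL hab)
  · rw [edgeSet_hidingGraph] at he
    induction e using Sym2.ind with | _ a b
    exact (weight_arcDigraph_eq_zero (fun a b => s(a, b) ∈ S) (L.ZeroEdge σ) hS a b).trans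
       ⟨fun h => h.2, fun h => ⟨he, h⟩⟩

/-- If `σ i ≠ τ i`, a common tree would contain two different paths from `0` to leaf `i`, through
the middle vertices `σ i` and `τ i`. -/
lemma disjoint_minSpanningTrees {σ τ : Fin r → Fin k} (h : σ ≠ τ) :
    Disjoint (L.hidingGraph hS σ).minSpanningTrees (L.hidingGraph hS τ).minSpanningTrees := by
  rw [Set.disjoint_left]
  intro F hF hF'
  obtain ⟨i, hi⟩ := Function.ne_iff.1 h
  set T := SimpleGraph.fromEdgeSet (F : Set (Sym2 (Fin n)))
  have hT : T.IsAcyclic := hF.1.2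
  have h0 : ∀ j, (∃ ρ : Fin r → Fin k, F ∈ (L.hidingGraph hS ρ).minSpanningTrees ∧ ρ i = j) →
      T.Adj 0 (L.mid j) ∧ T.Adj (L.mid j) (L.leaf i) := by
    rintro j ⟨ρ, hρ, rfl⟩
    simp only [T, SimpleGraph.fromEdgeSet_adj, Finset.mem_coe]
    exact ⟨⟨L.mem_of_mem_minSpanningTrees hS hL hρ (Or.inl ⟨rfl, _, rfl⟩), (L.mid_ne_zero _).symm⟩,
      L.mem_of_mem_minSpanningTrees hS hL hρ ((L.zeroArc_mid_leaf ρ _ i).2 rfl), L.mid_ne_leaf _ _⟩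
  obtain ⟨a1, a2⟩ := h0 (σ i) ⟨σ, hF, rfl⟩
  obtain ⟨b1, b2⟩ := h0 (τ i) ⟨τ, hF', rfl⟩
  have hp : ∀ j (c1 : T.Adj 0 (L.mid j)) (c2 : T.Adj (L.mid j) (L.leaf i)),
      (SimpleGraph.Walk.cons c1 (SimpleGraph.Walk.cons c2 SimpleGraph.Walk.nil)).IsPath := by
    intro j c1 c2
    simp [SimpleGraph.Walk.isPath_def, L.mid_ne_leaf, (L.mid_ne_zero j).symm,
      (L.leaf_ne_zero i).symm]
  have heq := (hT.subsingleton_path 0 (L.leaf i)).elim ⟨_, hp _ a1 a2⟩ ⟨_, hp _ b1 b2⟩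
  have hsnd := congrArg (fun p : T.Path 0 (L.leaf i) => p.1.snd) heq
  exact hi (L.mid_injective hsnd)

variable {W : ℕ} {ε : ℝ}
include hS

lemma le_queries_of_solvesMSTArray (hε : ε < 1 / 2) (hW : 1 ≤ W) (hk : 2 ≤ k) (hr : 0 < r)
    (𝒜 : QueryAlgorithm (Σ i, Fin (outDeg (fun a b => s(a, b) ∈ S) i)) (Fin n × Fin (W + 1))
      (Finset (Sym2 (Fin n)))) (h𝒜 : 𝒜.SolvesMSTArray ε) :
    (1 - 2 * ε) ^ 2 / 4 * (r * √((k : ℝ) - 1)) ≤ 𝒜.queries :=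
  𝒜.le_queries_of_hidden_positions hε hk
    (fun σ => arcArrays (fun a b => s(a, b) ∈ S) (L.ZeroEdge σ) W)
    (fun σ => (L.hidingGraph hS σ).minSpanningTrees)
    (fun _ _ h => L.disjoint_minSpanningTrees hS hL h)
    (exists_arcArrays_congr _ _ fun a b =>
      (L.exists_zeroArc_zeroEdge_congr (by omega) hr a b).imp fun _ h => h.imp fun _ h σ τ hστ =>
        (h σ τ hστ).2)
    fun σ => h𝒜 _ _ (hasArrays_arcDigraph _ _ hS hW)

lemma le_queries_of_solvesMSTMatrix (hε : ε < 1 / 2) (hW : 1 ≤ W) (hk : 2 ≤ k) (hr : 0 < r)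
    (𝒜 : QueryAlgorithm (Fin n × Fin n) (Fin (W + 2)) (Finset (Sym2 (Fin n))))
    (h𝒜 : 𝒜.SolvesMSTMatrix S.card ε) :
    (1 - 2 * ε) ^ 2 / 4 * (r * √((k : ℝ) - 1)) ≤ 𝒜.queries :=
  𝒜.le_queries_of_hidden_positions hε hk
    (fun σ => arcMatrix (fun a b => s(a, b) ∈ S) (L.ZeroEdge σ) W)
    (fun σ => (L.hidingGraph hS σ).minSpanningTrees)
    (fun _ _ h => L.disjoint_minSpanningTrees hS hL h)
    (exists_arcMatrix_congr _ _ fun a b =>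
      (L.exists_zeroArc_zeroEdge_congr (by omega) hr a b).imp fun _ h => h.imp fun _ h σ τ hστ =>
        (h σ τ hστ).2)
    fun σ => h𝒜 _ _ (L.numUndirectedEdges_hidingGraph hS σ) (hasMatrix_arcDigraph _ _ hS hW)

end SpanningTrees

section ShortestPaths

variable {S : Finset (Fin n × Fin n)} (hS : ∀ a, (a, a) ∉ S)

/-- The directed graph with arcs `S` whose arcs of weight zero are given by `σ`. -/
noncomputable def hidingDigraph (σ : Fin r → Fin k) : WeightedDigraph n :=
  arcDigraph (fun a b => (a, b) ∈ S) (L.ZeroArc σ) hS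

lemma numEdges_hidingDigraph (σ : Fin r → Fin k) : (L.hidingDigraph hS σ).numEdges = S.card := by
  rw [WeightedDigraph.numEdges, ← Set.ncard_coe_finset]
  congr 1
  ext e
  exact weight_arcDigraph_ne_top _ _ _ e.1 e.2

variable (hL : L.arcs ⊆ S)
include hL

/-- The path through `σ i` has length 0, so every shortest path does, and its last arc is the only
zero arc into the leaf. -/
lemma exists_eq_append_mid_leaf {σ : Fin r → Fin k} {P : Fin n → List (Fin n)}
    (hP : P ∈ (L.hidingDigraph hS σ).shortestPathSolutions 0) (i : Fin r) :
    ∃ l, P (L.leaf i) = l ++ [L.mid (σ i), L.leaf i] := by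
  have h1 : (L.hidingDigraph hS σ).weight 0 (L.mid (σ i)) = 0 :=
    (weight_arcDigraph_eq_zero _ _ _ _ _).2 ⟨hL (L.zero_mid_mem_arcs _), Or.inl ⟨rfl, _, rfl⟩⟩
  have h2 : (L.hidingDigraph hS σ).weight (L.mid (σ i)) (L.leaf i) = 0 :=
    (weight_arcDigraph_eq_zero _ _ _ _ _).2
      ⟨hL (L.mid_leaf_mem_arcs _ _), (L.zeroArc_mid_leaf σ _ i).2 rfl⟩
  have hpath : (L.hidingDigraph hS σ).IsPath 0 (L.leaf i) [0, L.mid (σ i), L.leaf i] := by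
    refine ⟨rfl, rfl, ?_, ?_⟩
    · simp [(L.mid_ne_zero _).symm, (L.leaf_ne_zero _).symm, L.mid_ne_leaf]
    · simp [h1, h2]
  obtain ⟨hp, hmin⟩ := hP (L.leaf i) ⟨_, hpath⟩
  have hlen : (L.hidingDigraph hS σ).pathLength (P (L.leaf i)) = 0 := by
    refine le_antisymm ((hmin _ hpath).trans (le_of_eq ?_)) bot_le
    simp [WeightedDigraph.pathLength, h1, h2]
  obtain ⟨l, a, hl, ha⟩ := hp.exists_last_edge _ (L.leaf_ne_zero i).symm hlen
  refine ⟨l, ?_⟩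
  rw [hl, L.zeroArc_leaf ((weight_arcDigraph_eq_zero _ _ _ _ _).1 ha).2]

lemma disjoint_shortestPathSolutions {σ τ : Fin r → Fin k} (h : σ ≠ τ) :
    Disjoint ((L.hidingDigraph hS σ).shortestPathSolutions 0)
      ((L.hidingDigraph hS τ).shortestPathSolutions 0) := by
  rw [Set.disjoint_left]
  intro P hP hP'
  obtain ⟨i, hi⟩ := Function.ne_iff.1 h
  obtain ⟨l, hl⟩ := L.exists_eq_append_mid_leaf hS hL hP i
  obtain ⟨l', hl'⟩ := L.exists_eq_append_mid_leaf hS hL hP' i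
  have := (List.append_inj' (hl.symm.trans hl') rfl).2
  exact hi (L.mid_injective (List.cons.inj this).1)

variable {W : ℕ} {ε : ℝ}
include hS

lemma le_queries_of_solvesSSSPArray (hε : ε < 1 / 2) (hW : 1 ≤ W) (hk : 2 ≤ k) (hr : 0 < r)
    (𝒜 : QueryAlgorithm (Σ i, Fin (outDeg (fun a b => (a, b) ∈ S) i)) (Fin n × Fin (W + 1))
      (Fin n → List (Fin n))) (h𝒜 : 𝒜.SolvesSSSPArray ε) :
    (1 - 2 * ε) ^ 2 / 4 * (r * √((k : ℝ) - 1)) ≤ 𝒜.queries :=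
  𝒜.le_queries_of_hidden_positions hε hk
    (fun σ => arcArrays (fun a b => (a, b) ∈ S) (L.ZeroArc σ) W)
    (fun σ => (L.hidingDigraph hS σ).shortestPathSolutions 0)
    (fun _ _ h => L.disjoint_shortestPathSolutions hS hL h)
    (exists_arcArrays_congr _ _ fun a b =>
      (L.exists_zeroArc_zeroEdge_congr (by omega) hr a b).imp fun _ h => h.imp fun _ h σ τ hστ =>
        (h σ τ hστ).1)
    fun σ => h𝒜 _ _ (hasArrays_arcDigraph _ _ hS hW)

lemma le_queries_of_solvesSSSPMatrix (hε : ε < 1 / 2) (hW : 1 ≤ W) (hk : 2 ≤ k) (hr : 0 < r)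
    (𝒜 : QueryAlgorithm (Fin n × Fin n) (Fin (W + 2)) (Fin n → List (Fin n)))
    (h𝒜 : 𝒜.SolvesSSSPMatrix S.card ε) :
    (1 - 2 * ε) ^ 2 / 4 * (r * √((k : ℝ) - 1)) ≤ 𝒜.queries :=
  𝒜.le_queries_of_hidden_positions hε hk
    (fun σ => arcMatrix (fun a b => (a, b) ∈ S) (L.ZeroArc σ) W)
    (fun σ => (L.hidingDigraph hS σ).shortestPathSolutions 0)
    (fun _ _ h => L.disjoint_shortestPathSolutions hS hL h)
    (exists_arcMatrix_congr _ _ fun a b =>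
      (L.exists_zeroArc_zeroEdge_congr (by omega) hr a b).imp fun _ h => h.imp fun _ h σ τ hστ =>
        (h σ τ hστ).1)
    fun σ => h𝒜 _ _ (L.numEdges_hidingDigraph hS σ) (hasMatrix_arcDigraph _ _ hS hW)

end ShortestPaths

end Layers

/-! ### Degree sums, layer sizes and the final bound -/

section Degrees

variable {n : ℕ}

lemma sum_outDeg_arcs (S : Finset (Fin n × Fin n)) :
    ∑ a, outDeg (fun a b => (a, b) ∈ S) a = S.card := by
  classical
  simp only [outDeg, Finset.card_filter]
  rw [← Fintype.sum_prod_type', ← Finset.card_filter]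
  congr 1
  ext e
  simp

lemma sum_outDeg_edges {S : Finset (Sym2 (Fin n))} (hS : ∀ a, s(a, a) ∉ S) :
    ∑ a, outDeg (fun a b => s(a, b) ∈ S) a = 2 * S.card := by
  classical
  obtain ⟨H, hadj⟩ : ∃ H : SimpleGraph (Fin n), ∀ a b, H.Adj a b ↔ s(a, b) ∈ S := by
    refine ⟨SimpleGraph.fromEdgeSet (S : Set (Sym2 (Fin n))), fun a b => ?_⟩
    rw [SimpleGraph.fromEdgeSet_adj, Finset.mem_coe, and_iff_left_iff_imp]
    rintro h rfl
    exact hS a h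
  refine Eq.trans (Finset.sum_congr rfl fun a _ => ?_)
    (H.sum_degrees_eq_twice_card_edges.trans (congrArg (2 * #·) ?_))
  swap
  · ext e
    induction e using Sym2.ind with | _ a b
    rw [SimpleGraph.mem_edgeFinset]
    exact hadj a b
  rw [outDeg, ← SimpleGraph.card_neighborFinset_eq_degree]
  congr 1
  ext b
  simp [hadj]

end Degrees

/-- Numbers of vertices for the layers that fit into `n` vertices and `m` edges. -/
lemma exists_layer_sizes {n m : ℕ} (hn : 16 ≤ n) (h1 : n - 1 ≤ m) (h2 : m ≤ n * (n - 1)) :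
    ∃ k r : ℕ, 2 ≤ k ∧ 0 < r ∧ k + r < n ∧ k + k * r ≤ m ∧
      √((n : ℝ) * m) / 32 ≤ r * √((k : ℝ) - 1) := by
  have hn0 : (0 : ℝ) < n := by exact_mod_cast (by omega : 0 < n)
  -- The summand 2 gives `k ≥ 2` and `k - 1 ≥ m / (4 * n)` despite rounding. The edges number at
  -- most about `m / 4 + n / 4 + 2`, which is below `m` because `m ≥ n - 1`.
  refine ⟨m / (4 * n) + 2, n / 8, Nat.le_add_left _ _, by omega, ?_, ?_, ?_⟩
  · have h3 : m / (4 * n) ≤ n / 4 := by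
      rw [← Nat.div_div_eq_div_mul, Nat.div_div_eq_div_mul, mul_comm 4 n,
        ← Nat.div_div_eq_div_mul]
      refine Nat.div_le_div_right (Nat.div_le_of_le_mul (h2.trans ?_))
      exact Nat.mul_le_mul_left n (Nat.sub_le n 1)
    omega
  · set t := m / (4 * n) with ht
    have h3 : t * (4 * n) ≤ m := Nat.div_mul_le_self m (4 * n)
    have h4 : t * (n / 8 + 1) ≤ t * n := Nat.mul_le_mul_left t (by omega)
    have h5 : t * (4 * n) = 4 * (t * n) := by ring
    have h6 : t + 2 + (t + 2) * (n / 8) = t * (n / 8 + 1) + 2 * (n / 8) + 2 := by ring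
    omega
  · have hr : (n : ℝ) / 16 ≤ ((n / 8 : ℕ) : ℝ) := by
      have : n ≤ 16 * (n / 8) := by omega
      have : (n : ℝ) ≤ 16 * ((n / 8 : ℕ) : ℝ) := by exact_mod_cast this
      linarith
    have hk : (m : ℝ) / (4 * n) ≤ ((m / (4 * n) + 2 : ℕ) : ℝ) - 1 := by
      have : m < 4 * n * (m / (4 * n) + 1) := Nat.lt_mul_div_succ m (by omega)
      have : (m : ℝ) < 4 * n * ((m / (4 * n) : ℕ) + 1) := by exact_mod_cast this
      rw [div_le_iff₀ (by positivity)]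
      push_cast at this ⊢
      linarith
    have e : √((n : ℝ) * m) / 32 = n / 16 * √((m : ℝ) / (4 * n)) := by
      have h : (n : ℝ) * m = (2 * n) ^ 2 * (m / (4 * n)) := by
        field_simp
        ring
      rw [h, Real.sqrt_mul (by positivity), Real.sqrt_sq (by positivity)]
      ring
    rw [e]
    exact mul_le_mul hr (Real.sqrt_le_sqrt hk) (Real.sqrt_nonneg _) (Nat.cast_nonneg _)

theorem mainTheorem8 (ε : ℝ) (hε₀ : 0 ≤ ε) (hε : ε < 1 / 2) :
    ∃ c : ℝ, 0 < c ∧ ∃ n₀ : ℕ, ∀ (n m W : ℕ) [NeZero n],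
      n₀ ≤ n → n - 1 ≤ m → 1 ≤ W →
      (m ≤ n * (n - 1) / 2 →
        (∃ d : Fin n → ℕ, ∑ i, d i = 2 * m ∧
          ∀ 𝒜 : QueryAlgorithm (Σ i, Fin (d i)) (Fin n × Fin (W + 1)) (Finset (Sym2 (Fin n))),
            𝒜.SolvesMSTArray ε → c * √((n : ℝ) * m) ≤ 𝒜.queries) ∧
        (∀ 𝒜 : QueryAlgorithm (Fin n × Fin n) (Fin (W + 2)) (Finset (Sym2 (Fin n))),
            𝒜.SolvesMSTMatrix m ε → c * √((n : ℝ) * m) ≤ 𝒜.queries)) ∧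
      (m ≤ n * (n - 1) →
        (∃ d : Fin n → ℕ, ∑ i, d i = m ∧
          ∀ 𝒜 : QueryAlgorithm (Σ i, Fin (d i)) (Fin n × Fin (W + 1)) (Fin n → List (Fin n)),
            𝒜.SolvesSSSPArray ε → c * √((n : ℝ) * m) ≤ 𝒜.queries) ∧
        (∀ 𝒜 : QueryAlgorithm (Fin n × Fin n) (Fin (W + 2)) (Fin n → List (Fin n)),
            𝒜.SolvesSSSPMatrix m ε → c * √((n : ℝ) * m) ≤ 𝒜.queries)) := by
  have hD : 0 < (1 - 2 * ε) ^ 2 := pow_pos (by linarith) 2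
  -- The constant is the factor `1 / 4` of the adversary bound times the `1 / 32` lost in the layer
  -- sizes.
  refine ⟨(1 - 2 * ε) ^ 2 / 128, by positivity, 16, fun n m W _ hn h1 hW => ⟨fun h2 => ?_,
    fun h2 => ?_⟩⟩
  · obtain ⟨k, r, hk, hr, hkr, hm, hbound⟩ :=
      exists_layer_sizes hn h1 (h2.trans (Nat.div_le_self _ _))
    have hc : (1 - 2 * ε) ^ 2 / 128 * √((n : ℝ) * m) ≤
        (1 - 2 * ε) ^ 2 / 4 * (r * √((k : ℝ) - 1)) := by
      have := mul_le_mul_of_nonneg_left hbound (by positivity : 0 ≤ (1 - 2 * ε) ^ 2 / 4)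
      linarith
    obtain ⟨L⟩ := Layers.nonempty_of_lt hkr
    -- Pads the layered graph to exactly `m` edges without loops. `S` does not depend on `σ`, so the
    -- degrees are common to all inputs.
    obtain ⟨S, hLS, hS, rfl⟩ := Finset.exists_subsuperset_card_eq
      (s := L.arcs.image fun e => s(e.1, e.2))
      (t := univ.filter fun e : Sym2 (Fin n) => ¬ e.IsDiag) (n := m)
      (fun e he => by
        obtain ⟨p, hp, rfl⟩ := Finset.mem_image.1 he
        simpa using L.fst_ne_snd_of_mem_arcs hp)
      (Finset.card_image_le.trans (L.card_arcs_le.trans hm))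
      (by rw [← Fintype.card_subtype, Sym2.card_subtype_not_diag, Fintype.card_fin,
        Nat.choose_two_right]; exact h2)
    have hdiag : ∀ a, s(a, a) ∉ S := fun a ha => (Finset.mem_filter.1 (hS ha)).2 (by simp)
    have hL : ∀ e ∈ L.arcs, s(e.1, e.2) ∈ S := fun e he => hLS (Finset.mem_image_of_mem _ he)
    exact ⟨⟨_, sum_outDeg_edges hdiag, fun 𝒜 h𝒜 =>
      hc.trans (L.le_queries_of_solvesMSTArray hdiag hL hε hW hk hr 𝒜 h𝒜)⟩, fun 𝒜 h𝒜 =>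
      hc.trans (L.le_queries_of_solvesMSTMatrix hdiag hL hε hW hk hr 𝒜 h𝒜)⟩
  · obtain ⟨k, r, hk, hr, hkr, hm, hbound⟩ := exists_layer_sizes hn h1 h2
    have hc : (1 - 2 * ε) ^ 2 / 128 * √((n : ℝ) * m) ≤
        (1 - 2 * ε) ^ 2 / 4 * (r * √((k : ℝ) - 1)) := by
      have := mul_le_mul_of_nonneg_left hbound (by positivity : 0 ≤ (1 - 2 * ε) ^ 2 / 4)
      linarith
    obtain ⟨L⟩ := Layers.nonempty_of_lt hkr
    obtain ⟨S, hL, hS, rfl⟩ := Finset.exists_subsuperset_card_eq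
      (s := L.arcs) (t := (univ : Finset (Fin n)).offDiag) (n := m)
      (fun e he => by simpa using L.fst_ne_snd_of_mem_arcs he)
      (L.card_arcs_le.trans hm)
      (by rw [Finset.offDiag_card, Finset.card_univ, Fintype.card_fin, ← Nat.mul_sub_one]; exact h2)
    have hdiag : ∀ a, (a, a) ∉ S := fun a ha => (Finset.mem_offDiag.1 (hS ha)).2.2 rfl
    exact ⟨⟨_, sum_outDeg_arcs S, fun 𝒜 h𝒜 =>
      hc.trans (L.le_queries_of_solvesSSSPArray hdiag hL hε hW hk hr 𝒜 h𝒜)⟩, fun 𝒜 h𝒜 =>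
      hc.trans (L.le_queries_of_solvesSSSPMatrix hdiag hL hε hW hk hr 𝒜 h𝒜)⟩
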